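/- Let $A$ be an Arens-Michael algebra (a complete Hausdorff unital associative topological $\mathbb C$-algebra whose topology is generated by submultiplicative seminorms), let $\{\|\cdot\|_\lambda:\lambda\in\Lambda\}$ be a family of seminorms generating the topology of $A$ which is directed (for all $\lambda,\mu$ there are $\nu$ and $C$ with $\|\cdot\|_\lambda\le C\|\cdot\|_\nu$ and $\|\cdot\|_\mu\le C\|\cdot\|_\nu$), and let $\alpha$ be a topological algebra automorphism of $A$. *Notation.* Let $W_2$ be the set of finite words $w$ in the letters $1,2$, and $|w|$ the length of $w$. Let $p(w,k)$ be the number of letters $1$ minus the number of letters $2$ among the first $k$ letters of $w$, and $c(w)=p(w,|w|)$. For non-empty $w$ of length $m$ put $$i_w(r_1,\dots,r_m)=r_1\,\alpha^{p(w,1)}(r_2)\cdots\alpha^{p(w,m-1)}(r_m),$$ $$\|r\|_\lambda^{(w)}=\inf\Big\{\sum_{j=1}^k\|r_{1,j}\|_\lambda\cdots\|r_{m,j}\|_\lambda \;:\; r=\sum_{j=1}^k i_w(r_{1,j},\dots,r_{m,j})\Big\},$$ and put $\|r\|_\lambda^{(\emptyset)}=\|r\|_\lambda$. Let $A\{x_1,x_2;\alpha\}$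 be the algebra of all formal series $f=\sum_{w\in W_2}a_wx^w$ with $a_w\in A$ and $$\|f\|_{\lambda,\rho}=\sum_{w\in W_2}\|a_w\|_\lambda^{(w)}\rho^{|w|}<\infty\qquad\text{for all }\lambda\in\Lambda,\ 0<\rho<\infty,$$ with the topology generated by the seminorms $\|\cdot\|_{\lambda,\rho}$ and the multiplication determined by $(ax^u)(bx^v)=a\,\alpha^{c(u)}(b)\,x^{uv}$. Here $x_1,x_2$ are the one-letter words, and $A$ is embedded as the constant series. Let $A_\alpha$ be the bimodule which is $A$ as a left module, with right action $x\circ a=x\alpha(a)$; similarly $A_{\alpha^{-1}}$. For an Arens-Michael algebra $B$, a topologically compatible triple $(\theta,\varphi,\psi)$ on $B$ consists of a continuous algebra homomorphism $\theta:A\to B$ and continuous $A$-bimodule homomorphisms $\varphi:A_\alpha\to B$, $\psi:A_{\alpha^{-1}}\to B$ with $\varphi(x)\psi(y)=\theta(x\alpha(y))$ and $\psi(y)\varphi(x)=\theta(y\alpha^{-1}(x))$ for all $x\in A_\alpha$, $y\in A_{\alpha^{-1}}$. The analytic Laurent tensor algebra $\widehat L_A(A_\alpha)$ is the Arens-Michael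 algebra carrying a universal topologically compatible triple (it is unique up to isomorphism where it exists). **Lemma.** Let $w_n=1^n2^n$ and $w_n'=2^n1^n$. Suppose that $r\in A$ and that, for every $\lambda\in\Lambda$ and every $\rho>0$, at least one of $$\lim_{n\to\infty}\|r\|_\lambda^{(w_n)}\rho^{2n}=0,\qquad \lim_{n\to\infty}\|r\|_\lambda^{(w_n')}\rho^{2n}=0$$ holds. Then $r$ lies in the smallest closed two-sided ideal of $A\{x_1,x_2;\alpha\}$ that contains $x_1x_2-1$ and $x_2x_1-1$. If moreover $r$ is invertible in $A$, then $\widehat L_A(A_\alpha)$ exists and $\widehat L_A(A_\alpha)=0$. -/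

import Mathlib

open Filter Topology

universe u v

noncomputable section

namespace ArensMichael

/-- An Arens-Michael algebra: a complete Hausdorff topological algebra over the complex numbers whose
topology is generated by a family of submultiplicative seminorms. -/
class ArensMichaelAlgebra (A : Type u) [Ring A] [Algebra ℂ A] [UniformSpace A] : Prop
    extends IsUniformAddGroup A, CompleteSpace A, T2Space A where
  exists_submultiplicative : ∃ S : Set (Seminorm ℂ A),
    (∀ q ∈ S, ∀ x y : A, q (x * y) ≤ q x * q y) ∧
      WithSeminorms (fun q : S => (q : Seminorm ℂ A))

/-- A directed family of seminorms generating the topology. Directedness is understood up to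
constants. -/
structure IsDirectedGenerating {A : Type u} [Ring A] [Algebra ℂ A] [UniformSpace A]
    {Λ : Type v} (p : Λ → Seminorm ℂ A) : Prop where
  withSeminorms : WithSeminorms p
  directed : ∀ i j : Λ, ∃ (k : Λ) (C : ℝ), ∀ x : A, p i x ≤ C * p k x ∧ p j x ≤ C * p k x

/-! ### The bimodules `A_α` and the analytic Laurent tensor algebra -/

/-- The bimodule `A_α`: it is `A` as a left module, and the right action is `x ∘ a = x α(a)`. -/
def Twist {A : Type u} [Ring A] [Algebra ℂ A] [UniformSpace A] (_α : A ≃A[ℂ] A) : Type u := A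

namespace Twist

variable {A : Type u} [Ring A] [Algebra ℂ A] [UniformSpace A] (α : A ≃A[ℂ] A)

instance : AddCommGroup (Twist α) := inferInstanceAs (AddCommGroup A)

instance : UniformSpace (Twist α) := inferInstanceAs (UniformSpace A)

/-- The left action is the multiplication of `A`. -/
instance : Module A (Twist α) := inferInstanceAs (Module A A)

/-- The right action, `MulOpposite.op a • x = x * α a`. -/
instance : Module Aᵐᵒᵖ (Twist α) :=
  Module.compHom A (RingHom.op (α.toAlgEquiv : A →+* A))

variable {α}

/-- The element of `A_α` given by an element of `A`. -/
def of (a : A) : Twist α := a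

/-- The element of `A` underlying an element of `A_α`. -/
def val (x : Twist α) : A := x

theorem val_smul (a : A) (x : Twist α) : (a • x).val = a * x.val := rfl

theorem val_op_smul (a : A) (x : Twist α) : (MulOpposite.op a • x).val = x.val * α a := rfl

variable (α)

/-- The pairing `i₁ : A_α ⊗ A_{α⁻¹} → A`, `a ⊗ b ↦ a α(b)`. -/
def pairing₁ (x : Twist α) (y : Twist α.symm) : A := x.val * α y.val

/-- The pairing `i₂ : A_{α⁻¹} ⊗ A_α → A`, `b ⊗ a ↦ b α⁻¹(a)`. -/
def pairing₂ (y : Twist α.symm) (x : Twist α) : A := y.val * α.symm x.val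

end Twist

/-- A topologically compatible triple `(θ, φ, ψ)` on a topological algebra `B`, for the pair of
inverse bimodules `A_α`, `A_{α⁻¹}`: a continuous algebra homomorphism `θ : A → B` and continuous
bimodule homomorphisms `φ : A_α → B`, `ψ : A_{α⁻¹} → B` (the bimodule structure of `B` being given
by `θ`) which carry the pairings `i₁`, `i₂` to the multiplication of `B`. A continuous linear map
from a completed tensor product over `A` is the same as a continuous balanced bilinear map, so the
two commutative squares are written on pairs of elements. -/
structure CompatibleTriple {A : Type u} [Ring A] [Algebra ℂ A] [UniformSpace A] (α : A ≃A[ℂ] A)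
    (B : Type v) [Ring B] [Algebra ℂ B] [UniformSpace B] where
  θ : A →A[ℂ] B
  φ : Twist α →+ B
  ψ : Twist α.symm →+ B
  continuous_φ : Continuous φ
  continuous_ψ : Continuous ψ
  φ_left : ∀ (a : A) (x : Twist α), φ (a • x) = θ a * φ x
  φ_right : ∀ (a : A) (x : Twist α), φ (MulOpposite.op a • x) = φ x * θ a
  ψ_left : ∀ (a : A) (y : Twist α.symm), ψ (a • y) = θ a * ψ y
  ψ_right : ∀ (a : A) (y : Twist α.symm), ψ (MulOpposite.op a • y) = ψ y * θ a
  compatible₁ : ∀ (x : Twist α) (y : Twist α.symm), φ x * ψ y = θ (Twist.pairing₁ α x y)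
  compatible₂ : ∀ (y : Twist α.symm) (x : Twist α), ψ y * φ x = θ (Twist.pairing₂ α y x)

/-- An analytic Laurent tensor algebra of `A_α`: an Arens-Michael algebra with a topologically
compatible triple which is universal among all topologically compatible triples on Arens-Michael
algebras. It is unique up to isomorphism where it exists. -/
structure LaurentTensorAlgebra {A : Type u} [Ring A] [Algebra ℂ A] [UniformSpace A]
    (α : A ≃A[ℂ] A) where
  carrier : Type u
  [ring : Ring carrier]
  [algebra : Algebra ℂ carrier]
  [uniformSpace : UniformSpace carrier]
  [arensMichael : ArensMichaelAlgebra carrier]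
  triple : CompatibleTriple α carrier
  universal : ∀ (B : Type u) [Ring B] [Algebra ℂ B] [UniformSpace B] [ArensMichaelAlgebra B]
    (t : CompatibleTriple α B), ∃! f : carrier →A[ℂ] B,
      (∀ a, f (triple.θ a) = t.θ a) ∧ (∀ x, f (triple.φ x) = t.φ x) ∧
        (∀ y, f (triple.ψ y) = t.ψ y)

/-! ### Words and the seminorms attached to them -/

/-- Words in the two letters `1`, `2`; the letter `1` is `(0 : Fin 2)`, the letter `2` is
`(1 : Fin 2)`. -/
abbrev Word := List (Fin 2)

namespace Word

/-- The number of letters `1` minus the number of letters `2`. -/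
def height (w : Word) : ℤ := (w.map fun l => if l = 0 then (1 : ℤ) else -1).sum

/-- The word `1ⁿ 2ⁿ`. -/
def oneTwo (n : ℕ) : Word := List.replicate n 0 ++ List.replicate n 1

/-- The word `2ⁿ 1ⁿ`. -/
def twoOne (n : ℕ) : Word := List.replicate n 1 ++ List.replicate n 0

@[simp] theorem height_nil : height [] = 0 := rfl

theorem height_append (v w : Word) : height (v ++ w) = height v + height w := by
  simp [height]

end Word

section Seminorms

set_option linter.unusedSectionVars false

variable {A : Type u} [Ring A] [Algebra ℂ A] [UniformSpace A]

/-- The integer powers of `α`. -/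
def twistPow (α : A ≃A[ℂ] A) (n : ℤ) : A ≃ₐ[ℂ] A := α.toAlgEquiv ^ n

theorem twistPow_zero (α : A ≃A[ℂ] A) (a : A) : twistPow α 0 a = a := by
  simp [twistPow]

theorem twistPow_add (α : A ≃A[ℂ] A) (m n : ℤ) (a : A) :
    twistPow α (m + n) a = twistPow α m (twistPow α n a) := by
  simp [twistPow, zpow_add, AlgEquiv.mul_apply]

/-- The map `i_w (x₁, …, x_m) = x₁ α^{h₁}(x₂) ⋯ α^{h_{m-1}}(x_m)`, where `m` is the length of `w`
and `h_k` is the height of the prefix of length `k` of `w`. A tuple is given as a sequence, indexed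
from `0`, of which only the first `m` entries are used. -/
def tensorMap (α : A ≃A[ℂ] A) (w : Word) (x : ℕ → A) : A :=
  ((List.range w.length).map fun k => twistPow α (Word.height (w.take k)) (x k)).prod

/-- The product `p(x₁) ⋯ p(x_m)`, where `m` is the length of `w`. -/
def tensorCost (p : Seminorm ℂ A) (w : Word) (x : ℕ → A) : ℝ :=
  ∏ k ∈ Finset.range w.length, p (x k)

/-- `‖r‖^{(w)}`: for non-empty `w` the infimum of `∑ⱼ p(r_{1,j}) ⋯ p(r_{m,j})` over all finite lists
of tuples with `r = ∑ⱼ i_w (r_{1,j}, …, r_{m,j})`, and `p r` for the empty word. -/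
def wordNorm (p : Seminorm ℂ A) (α : A ≃A[ℂ] A) (w : Word) (r : A) : ℝ :=
  if w = [] then p r else
    sInf {s : ℝ | ∃ T : List (ℕ → A),
      (T.map (tensorMap α w)).sum = r ∧ (T.map (tensorCost p w)).sum = s}

variable (p : Seminorm ℂ A) (α : A ≃A[ℂ] A)

@[simp] theorem wordNorm_nil (r : A) : wordNorm p α [] r = p r := by simp [wordNorm]

theorem tensorCost_nonneg (w : Word) (x : ℕ → A) : 0 ≤ tensorCost p w x :=
  Finset.prod_nonneg fun _ _ => apply_nonneg p _

theorem cost_sum_nonneg (w : Word) (T : List (ℕ → A)) : 0 ≤ (T.map (tensorCost p w)).sum := by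
  apply List.sum_nonneg
  intro a ha
  obtain ⟨x, -, rfl⟩ := List.mem_map.1 ha
  exact tensorCost_nonneg p w x

theorem wordNorm_nonneg (w : Word) (r : A) : 0 ≤ wordNorm p α w r := by
  unfold wordNorm
  split_ifs
  · exact apply_nonneg p r
  · apply Real.sInf_nonneg
    rintro s ⟨T, -, rfl⟩
    exact cost_sum_nonneg p w T

theorem wordNorm_le {w : Word} (hw : w ≠ []) (T : List (ℕ → A)) :
    wordNorm p α w (T.map (tensorMap α w)).sum ≤ (T.map (tensorCost p w)).sum := by
  rw [wordNorm, if_neg hw]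
  apply csInf_le
  · refine ⟨0, ?_⟩
    rintro s ⟨T, -, rfl⟩
    exact cost_sum_nonneg p w T
  · exact ⟨T, rfl, rfl⟩

theorem wordNorm_tensorMap_le {w : Word} (hw : w ≠ []) (x : ℕ → A) :
    wordNorm p α w (tensorMap α w x) ≤ tensorCost p w x := by
  simpa using wordNorm_le p α hw [x]

theorem tensorMap_cons (l : Fin 2) (w : Word) (x : ℕ → A) :
    tensorMap α (l :: w) x = x 0 * ((List.range w.length).map fun k =>
      twistPow α (Word.height ((l :: w).take (k + 1))) (x (k + 1))).prod := by
  simp [tensorMap, List.range_succ_eq_map, twistPow_zero, Function.comp_def]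

theorem tensorMap_update_zero {w : Word} (hw : w ≠ []) (x : ℕ → A) (a : A) :
    tensorMap α w (Function.update x 0 (a * x 0)) = a * tensorMap α w x := by
  cases w with
  | nil => exact absurd rfl hw
  | cons l w => simp [tensorMap_cons, mul_assoc]

theorem exists_tensorMap_eq {w : Word} (hw : w ≠ []) (r : A) : ∃ x, tensorMap α w x = r := by
  refine ⟨Function.update (fun _ => 1) 0 (r * 1), ?_⟩
  rw [tensorMap_update_zero α hw (fun _ => (1 : A)) r]
  simp [tensorMap]

theorem exists_list_lt {w : Word} (hw : w ≠ []) (r : A) {ε : ℝ} (hε : 0 < ε) :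
    ∃ T : List (ℕ → A), (T.map (tensorMap α w)).sum = r ∧
      (T.map (tensorCost p w)).sum < wordNorm p α w r + ε := by
  obtain ⟨x, hx⟩ := exists_tensorMap_eq α hw r
  have hne : {s : ℝ | ∃ T : List (ℕ → A), (T.map (tensorMap α w)).sum = r ∧
      (T.map (tensorCost p w)).sum = s}.Nonempty := ⟨_, [x], by simp [hx], rfl⟩
  obtain ⟨s, ⟨T, hT, rfl⟩, hs⟩ := exists_lt_of_csInf_lt hne
    (show sInf _ < wordNorm p α w r + ε by rw [wordNorm, if_neg hw]; linarith)
  exact ⟨T, hT, hs⟩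

/-- A subadditive function which is bounded by `K` times the cost on elementary tensors is bounded
by `K` times the seminorm. -/
theorem le_wordNorm_of_elementary {w : Word} (hw : w ≠ []) (q : A → ℝ) {K : ℝ} (hK : 0 ≤ K)
    (h0 : q 0 ≤ 0) (hadd : ∀ a b, q (a + b) ≤ q a + q b)
    (h : ∀ x, q (tensorMap α w x) ≤ K * tensorCost p w x) (r : A) :
    q r ≤ K * wordNorm p α w r := by
  have key : ∀ T : List (ℕ → A), q (T.map (tensorMap α w)).sum ≤
      K * (T.map (tensorCost p w)).sum := by
    intro T
    induction T with
    | nil => simpa using h0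
    | cons x T ih =>
      simp only [List.map_cons, List.sum_cons, mul_add]
      exact (hadd _ _).trans (add_le_add (h x) ih)
  apply le_of_forall_pos_le_add
  intro ε hε
  obtain ⟨T, hT, hs⟩ := exists_list_lt p α hw r (ε := ε / (K + 1)) (by positivity)
  have h1 := key T
  rw [hT] at h1
  have h2 : K * (ε / (K + 1)) ≤ ε := by
    rw [mul_div_assoc', div_le_iff₀ (by positivity)]
    nlinarith
  nlinarith [mul_le_mul_of_nonneg_left hs.le hK]

theorem wordNorm_add_le (w : Word) (a b : A) :
    wordNorm p α w (a + b) ≤ wordNorm p α w a + wordNorm p α w b := by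
  by_cases hw : w = []
  · subst hw; simpa using map_add_le_add p a b
  apply le_of_forall_pos_le_add
  intro ε hε
  obtain ⟨S, hS, hs⟩ := exists_list_lt p α hw a (half_pos hε)
  obtain ⟨T, hT, ht⟩ := exists_list_lt p α hw b (half_pos hε)
  have := wordNorm_le p α hw (S ++ T)
  simp only [List.map_append, List.sum_append, hS, hT] at this
  linarith

theorem tensorCost_update_zero {w : Word} (hw : w ≠ []) (x : ℕ → A) (b : A) :
    tensorCost p w (Function.update x 0 b) =
      p b * ∏ k ∈ Finset.range (w.length - 1), p (x (k + 1)) := by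
  cases w with
  | nil => exact absurd rfl hw
  | cons l w =>
    simp [tensorCost, Finset.prod_range_succ']
    ring

theorem wordNorm_smul_le (w : Word) (c : ℂ) (a : A) :
    wordNorm p α w (c • a) ≤ ‖c‖ * wordNorm p α w a := by
  by_cases hw : w = []
  · subst hw; simp [map_smul_eq_mul]
  refine le_wordNorm_of_elementary p α hw (fun a => wordNorm p α w (c • a)) (norm_nonneg c)
    ?_ ?_ ?_ a
  · simpa using wordNorm_le p α hw []
  · intro a b
    simpa only [smul_add] using wordNorm_add_le p α w (c • a) (c • b)
  · intro x
    have h1 : c • tensorMap α w x =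
        tensorMap α w (Function.update x 0 (algebraMap ℂ A c * x 0)) := by
      rw [tensorMap_update_zero α hw, Algebra.smul_def]
    have h2 := tensorCost_update_zero p hw x (algebraMap ℂ A c * x 0)
    have h3 := tensorCost_update_zero p hw x (x 0)
    rw [Function.update_eq_self] at h3
    simp only [h1]
    refine (wordNorm_tensorMap_le p α hw _).trans ?_
    rw [h2, h3, ← Algebra.smul_def, map_smul_eq_mul, mul_assoc]

theorem wordNorm_zero (w : Word) : wordNorm p α w 0 = 0 :=
  le_antisymm (by simpa using wordNorm_smul_le p α w 0 0) (wordNorm_nonneg p α w 0)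

/-- `‖·‖^{(w)}` as a seminorm. -/
def wordSeminorm (w : Word) : Seminorm ℂ A :=
  Seminorm.ofSMulLE (wordNorm p α w) (wordNorm_zero p α w)
    (wordNorm_add_le p α w) (wordNorm_smul_le p α w)

@[simp] theorem wordSeminorm_apply (w : Word) (r : A) :
    wordSeminorm p α w r = wordNorm p α w r := rfl

end Seminorms

/-! ### Formal twisted series in two variables -/

/-- Formal series `∑ a_w x^w` over all words, given by their coefficients. -/
def FormalSeries {A : Type u} [Ring A] [Algebra ℂ A] [UniformSpace A] (_α : A ≃A[ℂ] A) : Type u :=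
  Word → A

namespace FormalSeries

variable {A : Type u} [Ring A] [Algebra ℂ A] [UniformSpace A] {α : A ≃A[ℂ] A}

instance : AddCommGroup (FormalSeries α) := inferInstanceAs (AddCommGroup (Word → A))

instance : Module ℂ (FormalSeries α) := inferInstanceAs (Module ℂ (Word → A))

/-- The coefficient of `x^w`. -/
def coeff (f : FormalSeries α) (w : Word) : A := f w

@[ext] theorem ext {f g : FormalSeries α} (h : ∀ w, f.coeff w = g.coeff w) : f = g := funext h

@[simp] theorem coeff_zero (w : Word) : (0 : FormalSeries α).coeff w = 0 := rfl

@[simp] theorem coeff_add (f g : FormalSeries α) (w : Word) :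
    (f + g).coeff w = f.coeff w + g.coeff w := rfl

@[simp] theorem coeff_smul (c : ℂ) (f : FormalSeries α) (w : Word) :
    (c • f).coeff w = c • f.coeff w := rfl

/-- The monomial `a x^w`. -/
def monomial (w : Word) (a : A) : FormalSeries α := fun v => if v = w then a else 0

theorem coeff_monomial (w : Word) (a : A) (v : Word) :
    (monomial w a : FormalSeries α).coeff v = if v = w then a else 0 := rfl

instance : One (FormalSeries α) := ⟨monomial [] 1⟩

/-- The multiplication, determined by `(a x^u) (b x^v) = a α^{height u}(b) x^{uv}`, that is, by
`x₁ a = α(a) x₁` and `x₂ a = α⁻¹(a) x₂`. -/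
instance : Mul (FormalSeries α) :=
  ⟨fun f g w => ∑ k ∈ Finset.range (w.length + 1),
    f.coeff (w.take k) * twistPow α (Word.height (w.take k)) (g.coeff (w.drop k))⟩

theorem coeff_one (w : Word) : (1 : FormalSeries α).coeff w = if w = [] then 1 else 0 := rfl

theorem coeff_mul (f g : FormalSeries α) (w : Word) :
    (f * g).coeff w = ∑ k ∈ Finset.range (w.length + 1),
      f.coeff (w.take k) * twistPow α (Word.height (w.take k)) (g.coeff (w.drop k)) := rfl

protected theorem mul_assoc (f g h : FormalSeries α) : f * g * h = f * (g * h) := by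
  ext w
  simp only [coeff_mul, Finset.sum_mul, map_sum, Finset.mul_sum, map_mul]
  rw [Finset.sum_sigma', Finset.sum_sigma']
  refine Finset.sum_nbij' (fun s => ⟨s.2, s.1 - s.2⟩) (fun s => ⟨s.1 + s.2, s.1⟩) ?_ ?_ ?_ ?_ ?_
  · rintro ⟨j, i⟩ hs
    simp only [Finset.mem_sigma, Finset.mem_range, List.length_take, List.length_drop] at hs ⊢
    omega
  · rintro ⟨i, k⟩ hs
    simp only [Finset.mem_sigma, Finset.mem_range, List.length_take, List.length_drop] at hs ⊢
    omega
  · rintro ⟨j, i⟩ hs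
    simp only [Finset.mem_sigma, Finset.mem_range, List.length_take] at hs
    have : i + (j - i) = j := by omega
    simp [this]
  · rintro ⟨i, k⟩ hs
    simp
  · rintro ⟨j, i⟩ hs
    simp only [Finset.mem_sigma, Finset.mem_range, List.length_take] at hs
    obtain ⟨k, rfl⟩ : ∃ k, j = i + k := ⟨j - i, by omega⟩
    have h1 : (w.take (i + k)).take i = w.take i := by
      rw [List.take_take]; congr 1; omega
    have h2 : (w.take (i + k)).drop i = (w.drop i).take k := by
      rw [List.drop_take]; congr 1; omega
    have h3 : w.take (i + k) = w.take i ++ (w.drop i).take k := List.take_add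
    have h4 : (w.drop i).drop k = w.drop (i + k) := by rw [List.drop_drop]
    simp only [Nat.add_sub_cancel_left]
    rw [h1, h2, h4, h3, Word.height_append, twistPow_add, mul_assoc]

instance : Ring (FormalSeries α) where
  __ := (inferInstance : AddCommGroup (FormalSeries α))
  mul f g := f * g
  one := 1
  mul_assoc := FormalSeries.mul_assoc
  one_mul f := by
    ext w
    rw [coeff_mul, Finset.sum_eq_single 0]
    · simp [coeff_one, twistPow_zero]
    · intro k hk hk0
      rw [Finset.mem_range] at hk
      rw [coeff_one, if_neg, zero_mul]
      intro h
      have := congrArg List.length h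
      simp only [List.length_take, List.length_nil] at this
      omega
    · simp
  mul_one f := by
    ext w
    rw [coeff_mul, Finset.sum_eq_single w.length]
    · simp [coeff_one]
    · intro k hk hk0
      rw [Finset.mem_range] at hk
      rw [coeff_one, if_neg, map_zero, mul_zero]
      intro h
      have := congrArg List.length h
      simp only [List.length_drop, List.length_nil] at this
      omega
    · simp
  left_distrib f g h := by
    ext w
    simp [coeff_mul, mul_add, Finset.sum_add_distrib]
  right_distrib f g h := by
    ext w
    simp [coeff_mul, add_mul, Finset.sum_add_distrib]
  zero_mul f := by
    ext w
    simp [coeff_mul]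
  mul_zero f := by
    ext w
    simp [coeff_mul]

instance : Algebra ℂ (FormalSeries α) :=
  Algebra.ofModule
    (by intro c f g; ext w; simp [coeff_mul, Finset.smul_sum])
    (by intro c f g; ext w; simp [coeff_mul, Finset.smul_sum])

end FormalSeries

/-! ### Multiplicative estimates -/

section Estimates

set_option linter.unusedSectionVars false

variable {A : Type u} [Ring A] [Algebra ℂ A] [UniformSpace A]

theorem tensorMap_append (α : A ≃A[ℂ] A) (v w : Word) (x y : ℕ → A) :
    tensorMap α (v ++ w) (fun k => if k < v.length then x k else y (k - v.length)) =
      tensorMap α v x * twistPow α (Word.height v) (tensorMap α w y) := by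
  simp only [tensorMap, List.length_append, List.range_add, List.map_append, List.prod_append,
    List.map_map, map_list_prod]
  congr 2
  · apply List.map_congr_left
    intro k hk
    rw [List.mem_range] at hk
    simp only [hk, if_true]
    rw [List.take_append_of_le_length hk.le]
  · apply List.map_congr_left
    intro k hk
    simp [Word.height_append, twistPow_add, List.take_append,
      List.take_of_length_le (show v.length ≤ v.length + k by omega)]

theorem tensorCost_append (p : Seminorm ℂ A) (v w : Word) (x y : ℕ → A) :
    tensorCost p (v ++ w) (fun k => if k < v.length then x k else y (k - v.length)) =
      tensorCost p v x * tensorCost p w y := by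
  simp only [tensorCost, List.length_append, Finset.prod_range_add]
  congr 1
  · apply Finset.prod_congr rfl
    intro k hk
    rw [Finset.mem_range] at hk
    simp [hk]
  · apply Finset.prod_congr rfl
    intro k hk
    simp

/-- `p` is controlled by `q` with the constant `D`, as is needed to estimate products. -/
structure Controls (α : A ≃A[ℂ] A) (p q : Seminorm ℂ A) (D : ℝ) : Prop where
  one_le : 1 ≤ D
  le : ∀ x, p x ≤ D * q x
  mul : ∀ x y, p (x * y) ≤ D * (q x * q y)
  mul_twist : ∀ x y, p (x * twistPow α 1 y) ≤ D * (q x * q y)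
  mul_twist_neg : ∀ x y, p (x * twistPow α (-1) y) ≤ D * (q x * q y)

theorem IsDirectedGenerating.exists_bound {Λ : Type v} {p : Λ → Seminorm ℂ A}
    (hp : IsDirectedGenerating p) (i₀ : Λ) (S : List (Seminorm ℂ A)) (hS : ∀ q ∈ S, Continuous q) :
    ∃ (k : Λ) (D : ℝ), 1 ≤ D ∧ ∀ q ∈ S, ∀ x, q x ≤ D * p k x := by
  have sup : ∀ s : Finset Λ, ∃ (k : Λ) (D : ℝ), 1 ≤ D ∧ ∀ x, s.sup p x ≤ D * p k x := by
    classical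
    intro s
    induction s using Finset.induction_on with
    | empty =>
      refine ⟨i₀, 1, le_rfl, fun x => ?_⟩
      have := apply_nonneg (p i₀) x
      simp [this]
    | insert j s hj ih =>
      obtain ⟨k, D, hD, h⟩ := ih
      obtain ⟨l, C, hC⟩ := hp.directed j k
      refine ⟨l, max 1 (D * max C 1), le_max_left _ _, fun x => ?_⟩
      have hl := apply_nonneg (p l) x
      have h1 : p j x ≤ max 1 (D * max C 1) * p l x := by
        refine (hC x).1.trans (mul_le_mul_of_nonneg_right ?_ hl)
        refine le_trans ?_ (le_max_right _ _)
        have := le_max_left C 1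
        have := le_max_right C 1
        nlinarith
      have h2 : s.sup p x ≤ max 1 (D * max C 1) * p l x := by
        have h3 : p k x ≤ max C 1 * p l x :=
          (hC x).2.trans (mul_le_mul_of_nonneg_right (le_max_left _ _) hl)
        calc s.sup p x ≤ D * p k x := h x
          _ ≤ D * (max C 1 * p l x) := by gcongr
          _ = D * max C 1 * p l x := by ring
          _ ≤ _ := mul_le_mul_of_nonneg_right (le_max_right _ _) hl
      rw [Finset.sup_insert]
      exact sup_le h1 h2
  induction S with
  | nil => exact ⟨i₀, 1, le_rfl, by simp⟩
  | cons q S ih =>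
    obtain ⟨k, D, hD, h⟩ := ih fun q hq => hS q (List.mem_cons_of_mem _ hq)
    obtain ⟨s, C, -, hC⟩ := Seminorm.bound_of_continuous hp.withSeminorms q (hS q List.mem_cons_self)
    obtain ⟨l, E, hE, hs⟩ := sup s
    obtain ⟨m, F, hF⟩ := hp.directed k l
    refine ⟨m, max 1 (max (D * max F 1) (C * (E * max F 1))), le_max_left _ _, fun r hr x => ?_⟩
    have hm := apply_nonneg (p m) x
    have hF0 : 1 ≤ max F 1 := le_max_right _ _
    have hk : p k x ≤ max F 1 * p m x :=
      (hF x).1.trans (mul_le_mul_of_nonneg_right (le_max_left _ _) hm)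
    have hl : p l x ≤ max F 1 * p m x :=
      (hF x).2.trans (mul_le_mul_of_nonneg_right (le_max_left _ _) hm)
    rcases List.mem_cons.1 hr with rfl | hr
    · calc r x ≤ C * s.sup p x := hC x
        _ ≤ C * (E * (max F 1 * p m x)) := by
          gcongr
          exact (hs x).trans (by gcongr)
        _ = C * (E * max F 1) * p m x := by ring
        _ ≤ _ := mul_le_mul_of_nonneg_right
          ((le_max_right _ _).trans (le_max_right _ _)) hm
    · calc r x ≤ D * p k x := h r hr x
        _ ≤ D * (max F 1 * p m x) := by gcongr
        _ = D * max F 1 * p m x := by ring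
        _ ≤ _ := mul_le_mul_of_nonneg_right
          ((le_max_left _ _).trans (le_max_right _ _)) hm

theorem twistPow_one (α : A ≃A[ℂ] A) (a : A) : twistPow α 1 a = α a := by
  simp [twistPow]

theorem twistPow_neg_one (α : A ≃A[ℂ] A) (a : A) : twistPow α (-1) a = α.symm a := by
  have h : α (twistPow α (-1) a) = a := by
    rw [← twistPow_one, ← twistPow_add]
    simp [twistPow_zero]
  have h2 := congrArg α.symm h
  simpa using h2

theorem IsDirectedGenerating.exists_controls [ArensMichaelAlgebra A] {Λ : Type v}
    {p : Λ → Seminorm ℂ A} (hp : IsDirectedGenerating p) (α : A ≃A[ℂ] A) (i : Λ) :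
    ∃ (k : Λ) (D : ℝ), Controls α (p i) (p k) D := by
  obtain ⟨S, hS, hw⟩ := ArensMichaelAlgebra.exists_submultiplicative (A := A)
  have hcont : ∀ i, Continuous (p i) := hp.withSeminorms.continuous_seminorm
  obtain ⟨s, C, -, hC⟩ := Seminorm.bound_of_continuous hw (p i) (hcont i)
  set q : Seminorm ℂ A := s.sup fun q : S => (q : Seminorm ℂ A) with hq
  have hqc : Continuous q := by
    apply Seminorm.continuous_of_le (p := q) (q := ∑ j ∈ s, (j : Seminorm ℂ A))
    · have : ((∑ j ∈ s, (j : Seminorm ℂ A) : Seminorm ℂ A) : A → ℝ) =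
          fun x => ∑ j ∈ s, (j : Seminorm ℂ A) x := by
        have h := map_sum (FunLike.coeAddMonoidHom (Seminorm ℂ A) A ℝ)
          (fun j : S => (j : Seminorm ℂ A)) s
        simp only [FunLike.coeAddMonoidHom_apply] at h
        rw [h]
        ext x
        simp
      rw [this]
      exact continuous_finsetSum _ fun j _ => hw.continuous_seminorm j
    · exact Seminorm.finset_sup_le_sum _ _
  have hqmul : ∀ x y, q (x * y) ≤ q x * q y := by
    intro x y
    apply Seminorm.finset_sup_apply_le (mul_nonneg (apply_nonneg _ _) (apply_nonneg _ _))
    intro j hj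
    exact (hS j j.2 x y).trans (mul_le_mul (Seminorm.le_finset_sup_apply hj)
      (Seminorm.le_finset_sup_apply hj) (apply_nonneg _ _) (apply_nonneg _ _))
  let α₁ : A →ₗ[ℂ] A := α.toAlgEquiv.toLinearMap
  let α₂ : A →ₗ[ℂ] A := α.symm.toAlgEquiv.toLinearMap
  have h₁ : Continuous (q.comp α₁) := hqc.comp α.continuous
  have h₂ : Continuous (q.comp α₂) := hqc.comp α.symm.continuous
  obtain ⟨k, D, hD, h⟩ := hp.exists_bound i [p i, q, q.comp α₁, q.comp α₂] (by
    simp only [List.mem_cons, List.not_mem_nil, or_false]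
    rintro r (rfl | rfl | rfl | rfl)
    exacts [hcont i, hqc, h₁, h₂])
  have hi := h (p i) (by simp)
  have hq0 := h q (by simp)
  have hq1 := h (q.comp α₁) (by simp)
  have hq2 := h (q.comp α₂) (by simp)
  have main : ∀ x y z, q y ≤ D * p k z → p i (x * y) ≤ max D (C * D ^ 2) * (p k x * p k z) := by
    intro x y z hy
    have hx0 := apply_nonneg (p k) x
    have hz0 := apply_nonneg (p k) z
    calc p i (x * y) ≤ C * q (x * y) := hC _
      _ ≤ C * (q x * q y) := by gcongr; exact hqmul x y
      _ ≤ C * ((D * p k x) * (D * p k z)) := by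
        gcongr
        exact hq0 x
      _ = C * D ^ 2 * (p k x * p k z) := by ring
      _ ≤ _ := by gcongr; exact le_max_right _ _
  refine ⟨k, max D (C * D ^ 2), hD.trans (le_max_left _ _), fun x => ?_, fun x y => ?_,
    fun x y => ?_, fun x y => ?_⟩
  · exact (hi x).trans (mul_le_mul_of_nonneg_right (le_max_left _ _) (apply_nonneg _ _))
  · exact main x y y (hq0 y)
  · rw [twistPow_one]; exact main x _ y (hq1 y)
  · rw [twistPow_neg_one]; exact main x _ y (hq2 y)

theorem Controls.cost {α : A ≃A[ℂ] A} {p q : Seminorm ℂ A} {D : ℝ} (h : Controls α p q D)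
    (w : Word) (x : ℕ → A) : tensorCost p w x ≤ D ^ w.length * tensorCost q w x := by
  have := Finset.prod_le_prod (s := Finset.range w.length) (fun k _ => apply_nonneg p (x k))
    fun k _ => h.le (x k)
  simpa [tensorCost, Finset.prod_mul_distrib] using this

/-- The estimate behind the convergence of products. -/
theorem Controls.wordNorm_mul {α : A ≃A[ℂ] A} {p q : Seminorm ℂ A} {D : ℝ}
    (h : Controls α p q D) (v w : Word) (a b : A) :
    wordNorm p α (v ++ w) (a * twistPow α (Word.height v) b) ≤
      D * D ^ (v.length + w.length) * (wordNorm q α v a * wordNorm q α w b) := by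
  have hD := h.one_le
  have hD0 : 0 ≤ D := by linarith
  by_cases hv : v = []
  · subst hv
    by_cases hw : w = []
    · subst hw
      simpa [twistPow_zero] using h.mul a b
    · simp only [List.nil_append, Word.height_nil, twistPow_zero, wordNorm_nil, List.length_nil,
        zero_add]
      have := le_wordNorm_of_elementary q α hw (fun b => wordNorm p α w (a * b))
        (K := D * D ^ w.length * q a) (by positivity) (by simp [wordNorm_zero])
        (fun b c => by simpa only [mul_add] using wordNorm_add_le p α w (a * b) (a * c)) ?_ b
      · exact this.trans (le_of_eq (by ring))
      · intro y
        rw [← tensorMap_update_zero α hw]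
        refine (wordNorm_tensorMap_le p α hw _).trans ?_
        rw [tensorCost_update_zero p hw]
        have h3 := tensorCost_update_zero q hw y (y 0)
        rw [Function.update_eq_self] at h3
        rw [h3]
        have h4 : ∏ k ∈ Finset.range (w.length - 1), p (y (k + 1)) ≤
            D ^ (w.length - 1) * ∏ k ∈ Finset.range (w.length - 1), q (y (k + 1)) := by
          have := Finset.prod_le_prod (s := Finset.range (w.length - 1))
            (fun k _ => apply_nonneg p (y (k + 1))) fun k _ => h.le (y (k + 1))
          simpa [Finset.prod_mul_distrib] using this
        have h5 : D ^ (w.length - 1) ≤ D ^ w.length := pow_le_pow_right₀ hD (by omega)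
        have h6 : 0 ≤ ∏ k ∈ Finset.range (w.length - 1), q (y (k + 1)) :=
          Finset.prod_nonneg fun _ _ => apply_nonneg q _
        calc _ ≤ (D * (q a * q (y 0))) *
              (D ^ w.length * ∏ k ∈ Finset.range (w.length - 1), q (y (k + 1))) :=
              mul_le_mul (h.mul _ _) (h4.trans (mul_le_mul_of_nonneg_right h5 h6))
                (Finset.prod_nonneg fun _ _ => apply_nonneg p _) (by positivity)
          _ = _ := by ring
  · by_cases hw : w = []
    · subst hw
      simp only [List.append_nil, wordNorm_nil, List.length_nil, add_zero]
      have := le_wordNorm_of_elementary q α hv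
        (fun a => wordNorm p α v (a * twistPow α (Word.height v) b))
        (K := D * D ^ v.length * q b) (by positivity) (by simp [wordNorm_zero])
        (fun a c => by simpa only [add_mul] using wordNorm_add_le p α v _ _) ?_ a
      · exact this.trans (le_of_eq (by ring))
      · intro x
        obtain ⟨u, l, rfl⟩ : ∃ u l, v = u ++ [l] := 
          ⟨v.dropLast, v.getLast hv, (List.dropLast_append_getLast hv).symm⟩
        obtain ⟨e, he, hmul⟩ : ∃ e : ℤ, Word.height [l] = e ∧
            ∀ x y, p (x * twistPow α e y) ≤ D * (q x * q y) := by
          by_cases hl : l = 0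
          · exact ⟨1, by simp [Word.height, hl], h.mul_twist⟩
          · exact ⟨-1, by simp [Word.height, hl], h.mul_twist_neg⟩
        have hsplit : ∀ (c : A), tensorMap α (u ++ [l]) (fun k => if k < u.length then x k else c) =
            tensorMap α u x * twistPow α (Word.height u) c := by
          intro c
          have := tensorMap_append α u [l] x (fun _ => c)
          rw [this]
          simp [tensorMap, twistPow_zero]
        have hcost : ∀ (r : Seminorm ℂ A) (c : A),
            tensorCost r (u ++ [l]) (fun k => if k < u.length then x k else c) =
            tensorCost r u x * r c := by
          intro r c
          have := tensorCost_append r u [l] x (fun _ => c)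
          rw [this]
          simp [tensorCost]
        have hx : tensorMap α (u ++ [l]) x =
            tensorMap α u x * twistPow α (Word.height u) (x u.length) := by
          rw [← hsplit]
          unfold tensorMap
          congr 1
          apply List.map_congr_left
          intro k hk
          simp only [List.length_append, List.length_singleton, List.mem_range] at hk
          by_cases hk' : k < u.length
          · simp [hk']
          · have : k = u.length := by omega
            simp [this]
        have hcx : tensorCost q (u ++ [l]) x = tensorCost q u x * q (x u.length) := by
          simp [tensorCost, Finset.prod_range_succ]
        rw [hx, Word.height_append, he, twistPow_add, mul_assoc, ← map_mul, ← hsplit, hcx]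
        refine (wordNorm_tensorMap_le p α hv _).trans ?_
        rw [hcost]
        calc _ ≤ (D ^ u.length * tensorCost q u x) * (D * (q (x u.length) * q b)) :=
              mul_le_mul (h.cost u x) (hmul _ _) (apply_nonneg _ _)
                (mul_nonneg (by positivity) (tensorCost_nonneg q u x))
          _ = D * D ^ u.length * (q b * (tensorCost q u x * q (x u.length))) := by ring
          _ ≤ D * D ^ (u ++ [l]).length * (q b * (tensorCost q u x * q (x u.length))) := by
            apply mul_le_mul_of_nonneg_right
            · apply mul_le_mul_of_nonneg_left _ hD0
              exact pow_le_pow_right₀ hD (by simp)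
            · exact mul_nonneg (apply_nonneg _ _)
                (mul_nonneg (tensorCost_nonneg q u x) (apply_nonneg _ _))
          _ = _ := by ring
    · have hvw : v ++ w ≠ [] := by simp [hv]
      have step : ∀ x : ℕ → A, wordNorm p α (v ++ w)
          (tensorMap α v x * twistPow α (Word.height v) b) ≤
          (D ^ (v.length + w.length) * tensorCost q v x) * wordNorm q α w b := by
        intro x
        refine le_wordNorm_of_elementary q α hw
          (fun b => wordNorm p α (v ++ w) (tensorMap α v x * twistPow α (Word.height v) b))
          (mul_nonneg (by positivity) (tensorCost_nonneg q v x)) (by simp [wordNorm_zero])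
          (fun b c => by simpa only [map_add, mul_add] using wordNorm_add_le p α (v ++ w) _ _)
          ?_ b
        intro y
        rw [← tensorMap_append]
        refine (wordNorm_tensorMap_le p α hvw _).trans ?_
        rw [tensorCost_append]
        calc _ ≤ (D ^ v.length * tensorCost q v x) * (D ^ w.length * tensorCost q w y) :=
              mul_le_mul (h.cost v x) (h.cost w y) (tensorCost_nonneg p w y)
                (mul_nonneg (by positivity) (tensorCost_nonneg q v x))
          _ = _ := by ring
      have := le_wordNorm_of_elementary q α hv
        (fun a => wordNorm p α (v ++ w) (a * twistPow α (Word.height v) b))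
        (K := D ^ (v.length + w.length) * wordNorm q α w b)
        (mul_nonneg (by positivity) (wordNorm_nonneg q α w b)) (by simp [wordNorm_zero])
        (fun a c => by simpa only [add_mul] using wordNorm_add_le p α (v ++ w) _ _)
        (fun x => (step x).trans (le_of_eq (by ring))) a
      refine this.trans ?_
      have hn : 0 ≤ D ^ (v.length + w.length) * (wordNorm q α v a * wordNorm q α w b) :=
        mul_nonneg (by positivity) (mul_nonneg (wordNorm_nonneg _ _ _ _) (wordNorm_nonneg _ _ _ _))
      nlinarith

end Estimates

/-! ### The algebra `A{x₁, x₂; α}` -/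

section TwistedSeries

variable {A : Type u} [Ring A] [Algebra ℂ A] [UniformSpace A]
  {Λ : Type v} {p : Λ → Seminorm ℂ A}

variable (p) in
/-- The convergence condition `∑_w ‖a_w‖_λ^{(w)} ρ^{|w|} < ∞` for all `λ` and all `0 < ρ < ∞`. -/
def IsConvergent {α : A ≃A[ℂ] A} (f : FormalSeries α) : Prop :=
  ∀ (i : Λ) (ρ : ℝ), 0 < ρ →
    Summable fun w : Word => wordSeminorm (p i) α w (f.coeff w) * ρ ^ w.length

theorem IsConvergent.add {α : A ≃A[ℂ] A} {f g : FormalSeries α} (hf : IsConvergent p f)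
    (hg : IsConvergent p g) : IsConvergent p (f + g) := by
  intro i ρ hρ
  refine Summable.of_nonneg_of_le
    (fun w => mul_nonneg (apply_nonneg _ _) (by positivity)) (fun w => ?_)
    ((hf i ρ hρ).add (hg i ρ hρ))
  rw [← add_mul]
  exact mul_le_mul_of_nonneg_right (map_add_le_add _ _ _) (by positivity)

theorem IsConvergent.smul {α : A ≃A[ℂ] A} {f : FormalSeries α} (hf : IsConvergent p f) (c : ℂ) :
    IsConvergent p (c • f) := by
  intro i ρ hρ
  have := (hf i ρ hρ).mul_left ‖c‖
  simpa only [FormalSeries.coeff_smul, map_smul_eq_mul, mul_assoc] using this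

theorem isConvergent_monomial (α : A ≃A[ℂ] A) (w : Word) (a : A) :
    IsConvergent p (FormalSeries.monomial w a : FormalSeries α) := by
  intro i ρ hρ
  refine summable_of_ne_finset_zero (s := {w}) fun v hv => ?_
  rw [Finset.mem_singleton] at hv
  rw [FormalSeries.coeff_monomial, if_neg hv, map_zero, zero_mul]

theorem IsConvergent.mul [ArensMichaelAlgebra A] (hp : IsDirectedGenerating p) {α : A ≃A[ℂ] A}
    {f g : FormalSeries α} (hf : IsConvergent p f) (hg : IsConvergent p g) :
    IsConvergent p (f * g) := by
  intro i ρ hρ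
  obtain ⟨k, D, hD⟩ := hp.exists_controls α i
  have hD0 : 0 < D := lt_of_lt_of_le one_pos hD.one_le
  have hDρ : 0 < D * ρ := mul_pos hD0 hρ
  have hprod := (((hf k (D * ρ) hDρ).mul_of_nonneg (hg k (D * ρ) hDρ)
    (fun w => mul_nonneg (apply_nonneg _ _) (by positivity))
    (fun w => mul_nonneg (apply_nonneg _ _) (by positivity))).mul_left D)
  let e : (Σ w : Word, Fin (w.length + 1)) → Word × Word :=
    fun s => (s.1.take s.2, s.1.drop s.2)
  have he : Function.Injective e := by
    rintro ⟨w, m⟩ ⟨w', m'⟩ h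
    simp only [e, Prod.mk.injEq] at h
    obtain ⟨h1, h2⟩ := h
    have hw : w = w' := by
      rw [← List.take_append_drop m w, ← List.take_append_drop m' w', h1, h2]
    subst hw
    have hl := congrArg List.length h1
    simp only [List.length_take] at hl
    have hm := m.2
    have hm' := m'.2
    have : m = m' := Fin.ext (by omega)
    rw [this]
  have hs := (hprod.comp_injective he).sigma
  refine Summable.of_nonneg_of_le
    (fun w => mul_nonneg (apply_nonneg _ _) (by positivity)) (fun w => ?_) hs
  rw [tsum_fintype, FormalSeries.coeff_mul]
  have h1 : wordSeminorm (p i) α w (∑ m ∈ Finset.range (w.length + 1),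
      f.coeff (w.take m) * twistPow α (Word.height (w.take m)) (g.coeff (w.drop m))) ≤
      ∑ m ∈ Finset.range (w.length + 1), wordSeminorm (p i) α w
      (f.coeff (w.take m) * twistPow α (Word.height (w.take m)) (g.coeff (w.drop m))) :=
    Finset.le_sum_of_subadditive _ (map_zero _).le (map_add_le_add _) _ _
  refine (mul_le_mul_of_nonneg_right h1 (by positivity)).trans ?_
  rw [Finset.sum_mul, ← Fin.sum_univ_eq_sum_range (fun m => wordSeminorm (p i) α w
      (f.coeff (w.take m) * twistPow α (Word.height (w.take m)) (g.coeff (w.drop m))) *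
      ρ ^ w.length) (w.length + 1)]
  apply Finset.sum_le_sum
  intro m _
  have h2 := hD.wordNorm_mul (w.take m) (w.drop m) (f.coeff (w.take m)) (g.coeff (w.drop m))
  rw [List.take_append_drop] at h2
  have hlen : (w.take m).length + (w.drop m).length = w.length := by
    rw [← List.length_append, List.take_append_drop]
  simp only [Function.comp_apply, e, wordSeminorm_apply]
  refine (mul_le_mul_of_nonneg_right h2 (by positivity)).trans (le_of_eq ?_)
  have hpow : ρ ^ w.length = ρ ^ (w.take m).length * ρ ^ (w.drop m).length := by
    rw [← pow_add, hlen]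
  rw [mul_pow, mul_pow, hpow, pow_add]
  ring

/-- The convergent series, as a subalgebra of the algebra of formal series. -/
def convergentSubalgebra [ArensMichaelAlgebra A] (hp : IsDirectedGenerating p) (α : A ≃A[ℂ] A) :
    Subalgebra ℂ (FormalSeries α) where
  carrier := {f | IsConvergent p f}
  mul_mem' hf hg := IsConvergent.mul hp hf hg
  add_mem' hf hg := IsConvergent.add hf hg
  algebraMap_mem' c := by
    rw [Algebra.algebraMap_eq_smul_one]
    exact (isConvergent_monomial α [] 1).smul c

variable [ArensMichaelAlgebra A]

/-- The algebra `A{x₁, x₂; α}`, defined by means of a directed generating family of seminorms. -/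
def TwistedSeries (hp : IsDirectedGenerating p) (α : A ≃A[ℂ] A) : Type u :=
  convergentSubalgebra hp α

namespace TwistedSeries

variable {hp : IsDirectedGenerating p} {α : A ≃A[ℂ] A}

instance : Ring (TwistedSeries hp α) := inferInstanceAs (Ring (convergentSubalgebra hp α))

instance : Algebra ℂ (TwistedSeries hp α) :=
  inferInstanceAs (Algebra ℂ (convergentSubalgebra hp α))

/-- The coefficient of `x^w`. -/
def coeff (f : TwistedSeries hp α) (w : Word) : A := f.1.coeff w

theorem coeff_add (f g : TwistedSeries hp α) (w : Word) :
    (f + g).coeff w = f.coeff w + g.coeff w := rfl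

theorem coeff_smul (c : ℂ) (f : TwistedSeries hp α) (w : Word) :
    (c • f).coeff w = c • f.coeff w := rfl

theorem summable (f : TwistedSeries hp α) (i : Λ) {ρ : ℝ} (hρ : 0 < ρ) :
    Summable fun w : Word => wordSeminorm (p i) α w (f.coeff w) * ρ ^ w.length :=
  f.2 i ρ hρ

/-- The seminorm `‖f‖_{λ,ρ} = ∑_w ‖a_w‖_λ^{(w)} ρ^{|w|}`. -/
def seminorm (hp : IsDirectedGenerating p) (α : A ≃A[ℂ] A) (s : Λ × {ρ : ℝ // 0 < ρ}) :
    Seminorm ℂ (TwistedSeries hp α) :=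
  Seminorm.of
    (fun f => ∑' w : Word, wordSeminorm (p s.1) α w (f.coeff w) * (s.2 : ℝ) ^ w.length)
    (by
      intro f g
      have hf := f.summable s.1 s.2.2
      have hg := g.summable s.1 s.2.2
      rw [← hf.tsum_add hg]
      refine Summable.tsum_le_tsum (fun w => ?_) ((f + g).summable s.1 s.2.2) (hf.add hg)
      rw [← add_mul, coeff_add]
      exact mul_le_mul_of_nonneg_right (map_add_le_add _ _ _) (pow_nonneg s.2.2.le _))
    (by
      intro c f
      simp only [coeff_smul, map_smul_eq_mul, mul_assoc, tsum_mul_left])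

/-- The topology generated by the seminorms `‖·‖_{λ,ρ}`. -/
instance : TopologicalSpace (TwistedSeries hp α) :=
  (SeminormFamily.moduleFilterBasis (seminorm hp α)).topology

variable (hp α)

/-- The monomial `a x^w`. -/
def monomial (w : Word) (a : A) : TwistedSeries hp α :=
  ⟨FormalSeries.monomial w a, isConvergent_monomial α w a⟩

/-- An element of `A` as a constant series. -/
def const (a : A) : TwistedSeries hp α := monomial hp α [] a

/-- The variable `x₁`. -/
def x₁ : TwistedSeries hp α := monomial hp α [0] 1

/-- The variable `x₂`. -/
def x₂ : TwistedSeries hp α := monomial hp α [1] 1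

/-- The smallest closed two-sided ideal containing `x₁ x₂ - 1` and `x₂ x₁ - 1`. -/
def closedIdeal : TwoSidedIdeal (TwistedSeries hp α) :=
  sInf {I | IsClosed (I : Set (TwistedSeries hp α)) ∧
    x₁ hp α * x₂ hp α - 1 ∈ I ∧ x₂ hp α * x₁ hp α - 1 ∈ I}

end TwistedSeries

end TwistedSeries

end ArensMichael

end

namespace ArensMichael

/-! Membership in the ideal. Let `I` be a closed two-sided ideal containing `x₁x₂ - 1` and `x₂x₁ -
1`. Modulo `I` both `x₁ⁿx₂ⁿ` and `x₂ⁿx₁ⁿ` are `1`, so the constant `r` is congruent to each of the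
monomials with coefficient `r` and word `1ⁿ2ⁿ` or `2ⁿ1ⁿ`. The seminorm with index `(λ, ρ)` of such a
monomial is `‖r‖_λ^{(w)} ρ^{2n}`, which the hypothesis makes small for one of the two words. Which
word works may depend on `(λ, ρ)`, so a neighbourhood must first be reduced to a ball of a single
seminorm. This is possible because the family indexed by `(λ, ρ)` is directed
(`exists_finset_sup_seminorm_le`): a constant `C` between seminorms of `A` turns into a factor
`C^{|w|}`, which a larger radius absorbs. Hence `r` lies in the closure of `I`, that is, in `I`
(`const_mem_of_tendsto`).

Vanishing of the Laurent tensor algebra. The argument does not pass through the series algebra. For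
a compatible triple on `B`, the element `u = φ(1)` is a unit with inverse `ψ(1)`, and conjugation by
`u` implements `α` on the image of `θ`. Therefore `θ(i_w(x)) u^{c(w)}` is the product of the factors
`θ(x_k) u^{±1}`, one for each letter of `w` (`map_tensorMap_mul`). For `c(w) = 0` and a
submultiplicative continuous seminorm `q` on `B` this gives `q(θ r) ≤ K ‖r‖_λ^{(w)} M^{|w|}`, with
`K` and `M` independent of `w` (`seminorm_map_le`). With `ρ = M` the hypothesis forces `θ r = 0`. If
`r` is invertible, then `0` is a unit of `B`, so `B = 0`. Thus every Arens-Michael algebra carrying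
a triple is zero, and the zero algebra is universal. -/

theorem Word.length_oneTwo (n : ℕ) : (Word.oneTwo n).length = 2 * n := by
  simp [Word.oneTwo, two_mul]

theorem Word.length_twoOne (n : ℕ) : (Word.twoOne n).length = 2 * n := by
  simp [Word.twoOne, two_mul]

theorem Word.height_oneTwo (n : ℕ) : (Word.oneTwo n).height = 0 := by
  simp [Word.oneTwo, Word.height]

theorem Word.height_twoOne (n : ℕ) : (Word.twoOne n).height = 0 := by
  simp [Word.twoOne, Word.height]

/-! ### The family of seminorms of the algebra of twisted series is directed -/

/-- An elementary tensor for `w` has `|w|` factors, and each costs one `C`. The additional factor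
`C` serves the empty word, whose seminorm is `p` itself. -/
theorem wordNorm_le_of_le {A : Type u} [Ring A] [Algebra ℂ A] [UniformSpace A] (α : A ≃A[ℂ] A)
    {p q : Seminorm ℂ A} {C : ℝ} (hC : 1 ≤ C) (h : ∀ x, p x ≤ C * q x) (w : Word) (r : A) :
    wordNorm p α w r ≤ C * C ^ w.length * wordNorm q α w r := by
  by_cases hw : w = []
  · subst hw
    simpa using h r
  have hC0 : 0 ≤ C := zero_le_one.trans hC
  refine le_wordNorm_of_elementary q α hw (wordNorm p α w) (by positivity)
    (wordNorm_zero p α w).le (wordNorm_add_le p α w) (fun x => ?_) r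
  refine (wordNorm_tensorMap_le p α hw x).trans ?_
  have h1 : tensorCost p w x ≤ C ^ w.length * tensorCost q w x := by
    have := Finset.prod_le_prod (s := Finset.range w.length) (fun k _ => apply_nonneg p (x k))
      fun k _ => h (x k)
    simpa [tensorCost, Finset.prod_mul_distrib] using this
  refine h1.trans (mul_le_mul_of_nonneg_right ?_ (tensorCost_nonneg q w x))
  exact le_mul_of_one_le_left (by positivity) hC

/-- A cut of a word contributes only if its left part is `v` and its right part is `w`; this
determines the word, and the length of `v` determines the cut. -/
theorem FormalSeries.monomial_mul_monomial {A : Type u} [Ring A] [Algebra ℂ A] [UniformSpace A]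
    {α : A ≃A[ℂ] A} (v w : Word) (a b : A) :
    (monomial v a * monomial w b : FormalSeries α) =
      monomial (v ++ w) (a * twistPow α v.height b) := by
  ext z
  rw [coeff_mul, coeff_monomial]
  split_ifs with h
  · subst h
    rw [Finset.sum_eq_single v.length]
    · simp [coeff_monomial]
    · intro k hk hkv
      rw [Finset.mem_range] at hk
      rw [coeff_monomial, if_neg, zero_mul]
      intro h
      have := congrArg List.length h
      rw [List.length_take] at this
      omega
    · simp
  · refine Finset.sum_eq_zero fun k _ => ?_
    rw [coeff_monomial, coeff_monomial]
    split_ifs with h1 h2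
    · exact absurd (by rw [← h1, ← h2, List.take_append_drop]) h
    all_goals simp

namespace TwistedSeries

variable {A : Type u} [Ring A] [Algebra ℂ A] [UniformSpace A] [ArensMichaelAlgebra A]
  {Λ : Type v} {p : Λ → Seminorm ℂ A} (hp : IsDirectedGenerating p) (α : A ≃A[ℂ] A)

theorem withSeminorms : WithSeminorms (seminorm hp α) := ⟨rfl⟩

theorem seminorm_apply (s : Λ × {ρ : ℝ // 0 < ρ}) (f : TwistedSeries hp α) :
    seminorm hp α s f =
      ∑' w : Word, wordSeminorm (p s.1) α w (f.coeff w) * (s.2 : ℝ) ^ w.length := rfl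

theorem seminorm_monomial (s : Λ × {ρ : ℝ // 0 < ρ}) (w : Word) (a : A) :
    seminorm hp α s (monomial hp α w a) =
      wordSeminorm (p s.1) α w a * (s.2 : ℝ) ^ w.length := by
  have hcoeff : ∀ v, (monomial hp α w a).coeff v = if v = w then a else 0 := fun _ => rfl
  rw [seminorm_apply, tsum_eq_single w]
  · rw [hcoeff, if_pos rfl]
  · intro v hv
    rw [hcoeff, if_neg hv, map_zero, zero_mul]

/-- The factor `C^{|w|}` is not uniform in `w`, but `C^{|w|} ρ^{|w|} = (Cρ)^{|w|}`, so it disappears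
into the larger radius. -/
theorem seminorm_le_of_le {i k : Λ} {C : ℝ} (hC : 1 ≤ C) (h : ∀ x, p i x ≤ C * p k x)
    (ρ σ : {ρ : ℝ // 0 < ρ}) (hσ : C * ρ ≤ σ) (f : TwistedSeries hp α) :
    seminorm hp α (i, ρ) f ≤ C * seminorm hp α (k, σ) f := by
  rw [seminorm_apply, seminorm_apply, ← tsum_mul_left]
  refine Summable.tsum_le_tsum (fun w => ?_) (f.summable i ρ.2)
    ((f.summable k σ.2).mul_left C)
  have hC0 : 0 ≤ C := zero_le_one.trans hC
  have hρ0 : 0 ≤ (ρ : ℝ) := ρ.2.le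
  have h1 := wordNorm_le_of_le α hC h w (f.coeff w)
  have h2 := wordNorm_nonneg (p k) α w (f.coeff w)
  simp only [wordSeminorm_apply]
  calc _ ≤ C * C ^ w.length * wordNorm (p k) α w (f.coeff w) * (ρ : ℝ) ^ w.length := by gcongr
    _ = C * (wordNorm (p k) α w (f.coeff w) * (C * ρ) ^ w.length) := by rw [mul_pow]; ring
    _ ≤ _ := by gcongr

/-- Every basic neighbourhood thereby contains a ball of one seminorm, so that the alternative
between the two words has to be decided only once. -/
theorem exists_finset_sup_seminorm_le [Nonempty Λ] (s : Finset (Λ × {ρ : ℝ // 0 < ρ})) :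
    ∃ (t : Λ × {ρ : ℝ // 0 < ρ}) (C : ℝ), 0 < C ∧
      ∀ f, s.sup (seminorm hp α) f ≤ C * seminorm hp α t f := by
  classical
  induction s using Finset.induction_on with
  | empty =>
    refine ⟨(Classical.arbitrary Λ, ⟨1, one_pos⟩), 1, one_pos, fun f => ?_⟩
    simp only [Finset.sup_empty, Seminorm.bot_eq_zero, zero_apply, one_mul]
    exact apply_nonneg _ f
  | insert j s hj ih =>
    obtain ⟨⟨k, σ⟩, D, hD, h⟩ := ih
    obtain ⟨i, ρ⟩ := j
    obtain ⟨l, C, hC⟩ := hp.directed i k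
    -- Directedness gives an arbitrary real `C`; it is raised to at least `1`.
    have hC1 : 1 ≤ max C 1 := le_max_right _ _
    have hle : ∀ x, C * p l x ≤ max C 1 * p l x := fun x =>
      mul_le_mul_of_nonneg_right (le_max_left _ _) (apply_nonneg _ _)
    -- The common radius dominates both rescaled radii, that of the new index and that of the
    -- induction hypothesis.
    have hpos : 0 < max C 1 * max (ρ : ℝ) σ :=
      mul_pos (one_pos.trans_le hC1) (lt_max_of_lt_left ρ.2)
    refine ⟨(l, ⟨_, hpos⟩), max 1 D * max C 1, by positivity, fun f => ?_⟩
    have h1 := seminorm_le_of_le hp α hC1 (fun x => (hC x).1.trans (hle x)) ρ ⟨_, hpos⟩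
      (mul_le_mul_of_nonneg_left (le_max_left _ _) (by positivity)) f
    have h2 := seminorm_le_of_le hp α hC1 (fun x => (hC x).2.trans (hle x)) σ ⟨_, hpos⟩
      (mul_le_mul_of_nonneg_left (le_max_right _ _) (by positivity)) f
    have h0 : 0 ≤ max C 1 * seminorm hp α (l, ⟨_, hpos⟩) f :=
      mul_nonneg (by positivity) (apply_nonneg _ _)
    rw [Finset.sup_insert, mul_assoc]
    refine sup_le ?_ ?_
    · exact h1.trans (le_mul_of_one_le_left h0 (le_max_left _ _))
    · refine (h f).trans ?_
      exact mul_le_mul (le_max_right _ _) h2 (apply_nonneg _ _) (by positivity)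

/-! ### The closed ideal -/

theorem monomial_mul_monomial (v w : Word) (a b : A) :
    monomial hp α v a * monomial hp α w b =
      monomial hp α (v ++ w) (a * twistPow α v.height b) :=
  Subtype.ext (FormalSeries.monomial_mul_monomial v w a b)

theorem monomial_replicate (l : Fin 2) (n : ℕ) :
    monomial hp α (List.replicate n l) 1 = monomial hp α [l] 1 ^ n := by
  induction n with
  | zero => rfl
  | succ n ih =>
    rw [pow_succ, ← ih, monomial_mul_monomial, map_one, mul_one, List.replicate_succ']

theorem monomial_oneTwo (n : ℕ) (r : A) :
    monomial hp α (Word.oneTwo n) r = const hp α r * (x₁ hp α ^ n * x₂ hp α ^ n) := by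
  rw [x₁, x₂, ← monomial_replicate, ← monomial_replicate, monomial_mul_monomial, const,
    monomial_mul_monomial]
  simp [Word.oneTwo]

theorem monomial_twoOne (n : ℕ) (r : A) :
    monomial hp α (Word.twoOne n) r = const hp α r * (x₂ hp α ^ n * x₁ hp α ^ n) := by
  rw [x₁, x₂, ← monomial_replicate, ← monomial_replicate, monomial_mul_monomial, const,
    monomial_mul_monomial]
  simp [Word.twoOne]

/-- The innermost `ab` of `aⁿ(ab)bⁿ` is replaced by `1`, at the price of an element of the ideal. -/
theorem _root_.TwoSidedIdeal.pow_mul_pow_sub_one_mem {R : Type*} [Ring R] (I : TwoSidedIdeal R)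
    {a b : R} (h : a * b - 1 ∈ I) (n : ℕ) : a ^ n * b ^ n - 1 ∈ I := by
  induction n with
  | zero => simp
  | succ n ih =>
    have h1 : a ^ (n + 1) * b ^ (n + 1) - 1 =
        a ^ n * (a * b - 1) * b ^ n + (a ^ n * b ^ n - 1) := by
      rw [pow_succ, pow_succ']
      noncomm_ring
    rw [h1]
    exact I.add_mem (I.mul_mem_right _ _ (I.mul_mem_left _ _ h)) ih

variable {hp α}

theorem const_mem_of_tendsto {r : A}
    (hr : ∀ (i : Λ) (ρ : ℝ), 0 < ρ →
      Tendsto (fun n : ℕ => wordSeminorm (p i) α (Word.oneTwo n) r * ρ ^ (2 * n)) atTop (𝓝 0) ∨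
      Tendsto (fun n : ℕ => wordSeminorm (p i) α (Word.twoOne n) r * ρ ^ (2 * n)) atTop (𝓝 0))
    (I : TwoSidedIdeal (TwistedSeries hp α)) (hI : IsClosed (I : Set (TwistedSeries hp α)))
    (h₁ : x₁ hp α * x₂ hp α - 1 ∈ I) (h₂ : x₂ hp α * x₁ hp α - 1 ∈ I) :
    const hp α r ∈ I := by
  -- Used with `g = x₁ⁿx₂ⁿ` and `g = x₂ⁿx₁ⁿ`.
  have key : ∀ g, g - 1 ∈ I → const hp α r - const hp α r * g ∈ I := by
    intro g hg
    have h := I.neg_mem (I.mul_mem_left (const hp α r) _ hg)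
    rwa [mul_sub, mul_one, neg_sub] at h
  -- The class of `r` modulo `I` has representatives arbitrarily close to `0`.
  have hsmall : ∀ (s : Finset (Λ × {ρ : ℝ // 0 < ρ})) (ε : ℝ), 0 < ε →
      ∃ g, const hp α r - g ∈ I ∧ s.sup (seminorm hp α) g < ε := by
    intro s ε hε
    rcases isEmpty_or_nonempty Λ with hΛ | hΛ
    -- With no index at all the supremum is the zero seminorm, so any representative will do.
    · refine ⟨const hp α r, by simp, ?_⟩
      rw [Finset.eq_empty_of_isEmpty s]
      simpa using hε
    · obtain ⟨⟨i, ρ⟩, C, hC, hs⟩ := exists_finset_sup_seminorm_le hp α s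
      rcases hr i ρ ρ.2 with h | h
      · obtain ⟨n, hn⟩ := (h.eventually_lt_const (div_pos hε hC)).exists
        refine ⟨monomial hp α (Word.oneTwo n) r, ?_, (hs _).trans_lt ?_⟩
        · rw [monomial_oneTwo]
          exact key _ (I.pow_mul_pow_sub_one_mem h₁ n)
        · rwa [seminorm_monomial, Word.length_oneTwo, ← lt_div_iff₀' hC]
      · obtain ⟨n, hn⟩ := (h.eventually_lt_const (div_pos hε hC)).exists
        refine ⟨monomial hp α (Word.twoOne n) r, ?_, (hs _).trans_lt ?_⟩
        · rw [monomial_twoOne]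
          exact key _ (I.pow_mul_pow_sub_one_mem h₂ n)
        · rwa [seminorm_monomial, Word.length_twoOne, ← lt_div_iff₀' hC]
  have hmem : const hp α r ∈ closure (I : Set (TwistedSeries hp α)) := by
    rw [mem_closure_iff_nhds]
    intro U hU
    obtain ⟨s, ε, hε, hsub⟩ := ((withSeminorms hp α).mem_nhds_iff _ U).1 hU
    obtain ⟨g, hg, hlt⟩ := hsmall s ε hε
    -- This element of `I` differs from the constant `r` by the small `g`.
    refine ⟨const hp α r - g, hsub ?_, hg⟩
    rw [Seminorm.mem_ball, sub_sub_cancel_left, map_neg_eq_map]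
    exact hlt
  rwa [hI.closure_eq] at hmem

end TwistedSeries

/-! ### Compatible triples -/

namespace CompatibleTriple

variable {A : Type u} [Ring A] [Algebra ℂ A] [UniformSpace A] {α : A ≃A[ℂ] A}
  {B : Type v} [Ring B] [Algebra ℂ B] [UniformSpace B] (t : CompatibleTriple α B)

/-- The image of `1 ∈ A_α`, a unit with inverse the image of `1 ∈ A_{α⁻¹}`. -/
def unit : Bˣ where
  val := t.φ (Twist.of 1)
  inv := t.ψ (Twist.of 1)
  val_inv := by
    rw [t.compatible₁]
    simp [Twist.pairing₁, Twist.val, Twist.of]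
  inv_val := by
    rw [t.compatible₂]
    simp [Twist.pairing₂, Twist.val, Twist.of]

/-- In `A_α` the element `1 ∘ a` equals `α(a) · 1`; applying `φ` to both descriptions gives the
relation. -/
theorem unit_mul (a : A) : (t.unit : B) * t.θ a = t.θ (α a) * t.unit := by
  have h1 := t.φ_right a (Twist.of 1)
  have h2 := t.φ_left (α a) (Twist.of 1)
  have h3 : (MulOpposite.op a • Twist.of 1 : Twist α) = α a • Twist.of 1 :=
    (one_mul (α a)).trans (mul_one (α a)).symm
  rw [← h3, h1] at h2
  exact h2

/-- All integer powers are needed, because the prefix heights of a word may be negative. -/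
theorem map_twistPow_mul (n : ℤ) (a : A) :
    t.θ (twistPow α n a) * ↑(t.unit ^ n) = ↑(t.unit ^ n) * t.θ a := by
  have hone : ∀ b, t.θ (α b) = t.unit * t.θ b * ↑(t.unit⁻¹) := fun b => by
    rw [t.unit_mul, mul_assoc, Units.mul_inv, mul_one]
  induction n with
  | zero => simp [twistPow_zero]
  | succ n ih =>
    rw [add_comm, twistPow_add, twistPow_one, hone, zpow_add, zpow_one, Units.val_mul,
      mul_assoc, mul_assoc, Units.inv_mul_cancel_left, ih, mul_assoc]
  | pred n ih =>
    -- Downwards, the identity at `-n` is expressed through the one at `-n - 1`, and a factor `u` is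
    -- cancelled on the left.
    have h : t.θ (twistPow α (-n) a) =
        t.unit * t.θ (twistPow α (-n - 1) a) * ↑(t.unit⁻¹) := by
      rw [← hone, ← twistPow_one, ← twistPow_add, add_sub_cancel]
    rw [h] at ih
    have h2 : t.unit ^ (-(n : ℤ)) = t.unit * t.unit ^ (-(n : ℤ) - 1) := by
      rw [← zpow_one_add, add_sub_cancel]
    rw [h2, Units.val_mul, mul_assoc, mul_assoc, Units.inv_mul_cancel_left, mul_assoc] at ih
    exact t.unit.isUnit.mul_left_cancel ih

/-! ### Estimating `θ` by the word seminorms -/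

/-- The unit, or its inverse, attached to a letter. -/
def letter (l : Fin 2) : Bˣ := if l = 0 then t.unit else t.unit⁻¹

theorem letter_eq (l : Fin 2) : t.letter l = t.unit ^ Word.height [l] := by
  by_cases h : l = 0 <;> simp [letter, Word.height, h]

/-- Each twist `α^{p(w,k)}` becomes conjugation by `u^{p(w,k)}`. Between neighbouring factors these
powers combine to the `u^{±1}` of one letter, so no twist remains. The default value in `getD` is
never reached, since `k` is below the length. -/
theorem map_tensorMap_mul (w : Word) (x : ℕ → A) :
    t.θ (tensorMap α w x) * ↑(t.unit ^ w.height) =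
      ((List.range w.length).map fun k => t.θ (x k) * ↑(t.letter (w.getD k 0))).prod := by
  -- Letters are appended on the right because this leaves the earlier prefix heights unchanged.
  induction w using List.reverseRecOn with
  | nil => simp [tensorMap]
  | append_singleton w l ih =>
    have h1 : tensorMap α (w ++ [l]) x =
        tensorMap α w x * twistPow α (Word.height w) (x w.length) := by
      simp only [tensorMap, List.length_append, List.length_singleton, List.range_succ,
        List.map_append, List.prod_append, List.map_singleton, List.prod_singleton,
        List.take_left]
      congr 2
      refine List.map_congr_left fun k hk => ?_
      rw [List.take_append_of_le_length (List.mem_range.1 hk).le]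
    have h2 : ((List.range w.length).map fun k =>
        t.θ (x k) * (↑(t.letter ((w ++ [l]).getD k 0)) : B)) =
        (List.range w.length).map fun k => t.θ (x k) * ↑(t.letter (w.getD k 0)) := by
      refine List.map_congr_left fun k hk => ?_
      rw [List.getD_append _ _ _ _ (List.mem_range.1 hk)]
    rw [List.length_append, List.length_singleton, List.range_succ, List.map_append,
      List.prod_append, h2, ← ih, h1, map_mul, Word.height_append, zpow_add, ← letter_eq,
      Units.val_mul, mul_assoc, ← mul_assoc (t.θ (twistPow α (Word.height w) (x w.length))),
      map_twistPow_mul]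
    simp [mul_assoc]

/-- Height zero removes the power of `u`, and submultiplicativity bounds the remaining product
factor by factor. The constants must not depend on `w`, since `M` will be used as the radius `ρ`. -/
theorem seminorm_map_le {p : Seminorm ℂ A} {q : Seminorm ℂ B}
    (hq : ∀ x y, q (x * y) ≤ q x * q y) {C : ℝ} (hC : 0 ≤ C) (h : ∀ a, q (t.θ a) ≤ C * p a) :
    ∃ K M : ℝ, 0 ≤ K ∧ 0 < M ∧ ∀ (w : Word) (r : A), w ≠ [] → w.height = 0 →
      q (t.θ r) ≤ K * (wordNorm p α w r * M ^ w.length) := by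
  -- The summand `1` makes `M` positive, as a radius has to be.
  set M := C * max (q (t.letter 0)) (q (t.letter 1)) + 1 with hM
  have hm0 : 0 ≤ max (q (t.letter 0)) (q (t.letter 1)) := le_max_of_le_left (apply_nonneg _ _)
  have hM0 : 0 < M := by positivity
  refine ⟨q 1, M, apply_nonneg _ _, hM0, fun w r hw hh => ?_⟩
  have hfac : ∀ (a : A) (l : Fin 2), q (t.θ a * ↑(t.letter l)) ≤ M * p a := by
    intro a l
    have hl : q (t.letter l) ≤ max (q (t.letter 0)) (q (t.letter 1)) := by
      fin_cases l
      exacts [le_max_left _ _, le_max_right _ _]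
    have hp0 := apply_nonneg p a
    calc _ ≤ q (t.θ a) * q (t.letter l) := hq _ _
      _ ≤ (C * p a) * max (q (t.letter 0)) (q (t.letter 1)) :=
        mul_le_mul (h a) hl (apply_nonneg _ _) (by positivity)
      _ = (M - 1) * p a := by rw [hM]; ring
      _ ≤ _ := by gcongr; linarith
  -- The factor `q 1` comes from the empty product; submultiplicativity alone does not give `q 1 ≤
  -- 1`.
  have hprod : ∀ (n : ℕ) (f : ℕ → B) (g : ℕ → ℝ), (∀ k, q (f k) ≤ g k) →
      q ((List.range n).map f).prod ≤ q 1 * ∏ k ∈ Finset.range n, g k := by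
    intro n f g hfg
    induction n with
    | zero => simp
    | succ n ih =>
      rw [List.range_succ, List.map_append, List.prod_append, Finset.prod_range_succ, ← mul_assoc]
      simp only [List.map_singleton, List.prod_singleton]
      exact (hq _ _).trans (mul_le_mul ih (hfg n) (apply_nonneg _ _)
        ((apply_nonneg _ _).trans ih))
  refine (le_wordNorm_of_elementary p α hw (fun a => q (t.θ a)) (K := q 1 * M ^ w.length)
    (by positivity) (by simp) (fun a b => by simpa using map_add_le_add q _ _)
    (fun x => ?_) r).trans (le_of_eq (by ring))
  have h1 := t.map_tensorMap_mul w x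
  rw [hh, zpow_zero, Units.val_one, mul_one] at h1
  rw [h1]
  refine (hprod _ _ _ fun k => hfac (x k) _).trans (le_of_eq ?_)
  rw [Finset.prod_mul_distrib, Finset.prod_const, Finset.card_range, tensorCost, mul_assoc]

/-! ### Vanishing of `θ r` and of the target algebra -/

theorem map_eq_zero_of_tendsto [ArensMichaelAlgebra B] (t : CompatibleTriple α B) {Λ : Type*} {p : Λ → Seminorm ℂ A}
    [Nonempty Λ] (hp : IsDirectedGenerating p) {r : A}
    (hr : ∀ (i : Λ) (ρ : ℝ), 0 < ρ →
      Tendsto (fun n : ℕ => wordSeminorm (p i) α (Word.oneTwo n) r * ρ ^ (2 * n)) atTop (𝓝 0) ∨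
      Tendsto (fun n : ℕ => wordSeminorm (p i) α (Word.twoOne n) r * ρ ^ (2 * n)) atTop (𝓝 0)) :
    t.θ r = 0 := by
  obtain ⟨S, hS, hw⟩ := ArensMichaelAlgebra.exists_submultiplicative (A := B)
  by_contra hne
  -- As `B` is Hausdorff, a nonzero `θ r` would be seen by one of the submultiplicative seminorms.
  obtain ⟨q, hq⟩ := hw.separating_of_T1 _ hne
  refine hq (le_antisymm ?_ (apply_nonneg _ _))
  let θ' : A →ₗ[ℂ] B := t.θ.toAlgHom.toLinearMap
  have hcont : Continuous ((q : Seminorm ℂ B).comp θ') :=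
    (hw.continuous_seminorm q).comp t.θ.continuous
  obtain ⟨i, C, hC, hbound⟩ := hp.exists_bound (Classical.arbitrary Λ)
    [(q : Seminorm ℂ B).comp θ'] (by simpa using hcont)
  obtain ⟨K, M, hK, hM, hle⟩ := t.seminorm_map_le (hS q q.2) (zero_le_one.trans hC)
    (hbound _ (List.mem_singleton_self _))
  -- The radius is the constant `M` of the estimate, so along one of the two sequences of words the
  -- bound for `q (θ r)` tends to `0`.
  rcases hr i M hM with h | h
  · refine ge_of_tendsto (by simpa using h.const_mul K) ?_
    -- The estimate concerns non-empty words, hence `n > 0`.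
    filter_upwards [eventually_gt_atTop 0] with n hn
    have := hle (Word.oneTwo n) r (by simp [Word.oneTwo, hn.ne']) (Word.height_oneTwo n)
    rwa [Word.length_oneTwo] at this
  · refine ge_of_tendsto (by simpa using h.const_mul K) ?_
    filter_upwards [eventually_gt_atTop 0] with n hn
    have := hle (Word.twoOne n) r (by simp [Word.twoOne, hn.ne']) (Word.height_twoOne n)
    rwa [Word.length_twoOne] at this

theorem subsingleton_of_tendsto [ArensMichaelAlgebra A] [ArensMichaelAlgebra B]
    (t : CompatibleTriple α B) {Λ : Type*} {p : Λ → Seminorm ℂ A} (hp : IsDirectedGenerating p) {r : A}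
    (hr : ∀ (i : Λ) (ρ : ℝ), 0 < ρ →
      Tendsto (fun n : ℕ => wordSeminorm (p i) α (Word.oneTwo n) r * ρ ^ (2 * n)) atTop (𝓝 0) ∨
      Tendsto (fun n : ℕ => wordSeminorm (p i) α (Word.twoOne n) r * ρ ^ (2 * n)) atTop (𝓝 0))
    (hu : IsUnit r) : Subsingleton B := by
  have h0 : t.θ r = 0 := by
    rcases isEmpty_or_nonempty Λ with hΛ | hΛ
    -- An empty family separates points only if `r = 0`, and then `θ r = 0` as well.
    · by_contra hne
      obtain ⟨i, -⟩ := hp.withSeminorms.separating_of_T1 r fun h => hne (by rw [h, map_zero])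
      exact hΛ.elim i
    · exact t.map_eq_zero_of_tendsto hp hr
  have h1 := hu.map t.θ
  rw [h0, isUnit_zero_iff] at h1
  exact subsingleton_of_zero_eq_one h1

end CompatibleTriple

/-! ### The zero algebra -/

instance : ArensMichaelAlgebra PUnit.{u + 1} where
  exists_submultiplicative :=
    ⟨{0}, by simp, ⟨Subsingleton.elim _ _⟩⟩

/-- If all Arens-Michael algebras with a compatible triple are zero, then the zero algebra is an
analytic Laurent tensor algebra. -/
def LaurentTensorAlgebra.zero {A : Type u} [Ring A] [Algebra ℂ A] [UniformSpace A]
    (α : A ≃A[ℂ] A)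
    (h : ∀ (B : Type u) [Ring B] [Algebra ℂ B] [UniformSpace B] [ArensMichaelAlgebra B],
      CompatibleTriple α B → Subsingleton B) : LaurentTensorAlgebra α where
  carrier := PUnit.{u + 1}
  triple :=
    { θ :=
        { toFun := fun _ => 0
          map_one' := rfl
          map_mul' := fun _ _ => rfl
          map_zero' := rfl
          map_add' := fun _ _ => rfl
          commutes' := fun _ => rfl
          cont := continuous_const }
      φ := 0
      ψ := 0
      continuous_φ := continuous_const
      continuous_ψ := continuous_const
      φ_left := fun _ _ => rfl
      φ_right := fun _ _ => rfl
      ψ_left := fun _ _ => rfl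
      ψ_right := fun _ _ => rfl
      compatible₁ := fun _ _ => rfl
      compatible₂ := fun _ _ => rfl }
  universal B _ _ _ _ t := by
    -- Since `B` is zero, the zero map is unital and it is the only map into `B`.
    have := h B t
    refine ⟨{ toFun := fun _ => 0
              map_one' := Subsingleton.elim _ _
              map_mul' := fun _ _ => Subsingleton.elim _ _
              map_zero' := rfl
              map_add' := fun _ _ => Subsingleton.elim _ _
              commutes' := fun _ => Subsingleton.elim _ _
              cont := continuous_const }, ?_, ?_⟩
    · exact ⟨fun _ => Subsingleton.elim _ _, fun _ => Subsingleton.elim _ _,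
        fun _ => Subsingleton.elim _ _⟩
    · intro g _
      ext x
      exact Subsingleton.elim _ _

end ArensMichael

/-! ### The main statement -/

theorem lemmaA1 {A : Type u} [Ring A] [Algebra ℂ A] [UniformSpace A]
    [ArensMichael.ArensMichaelAlgebra A] {Λ : Type v} {p : Λ → Seminorm ℂ A}
    (hp : ArensMichael.IsDirectedGenerating p) (α : A ≃A[ℂ] A) (r : A)
    (hr : ∀ (i : Λ) (ρ : ℝ), 0 < ρ →
      Tendsto (fun n : ℕ =>
        ArensMichael.wordSeminorm (p i) α (ArensMichael.Word.oneTwo n) r * ρ ^ (2 * n))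
        atTop (𝓝 0) ∨
      Tendsto (fun n : ℕ =>
        ArensMichael.wordSeminorm (p i) α (ArensMichael.Word.twoOne n) r * ρ ^ (2 * n))
        atTop (𝓝 0)) :
    ArensMichael.TwistedSeries.const hp α r ∈ ArensMichael.TwistedSeries.closedIdeal hp α ∧
      (IsUnit r →
        Nonempty (ArensMichael.LaurentTensorAlgebra α) ∧
          ∀ L : ArensMichael.LaurentTensorAlgebra α, Subsingleton L.carrier) := by
  refine ⟨?_, fun hu => ⟨⟨.zero α fun B _ _ _ _ t => t.subsingleton_of_tendsto hp hr hu⟩,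
    fun L => ?_⟩⟩
  -- Membership in the intersection is tested on each closed ideal `I` separately.
  · rw [ArensMichael.TwistedSeries.closedIdeal, TwoSidedIdeal.mem_sInf]
    rintro I ⟨hI, h₁, h₂⟩
    exact ArensMichael.TwistedSeries.const_mem_of_tendsto hr I hI h₁ h₂
  · let _ := L.ring
    let _ := L.algebra
    let _ := L.uniformSpace
    have := L.arensMichael
    exact L.triple.subsingleton_of_tendsto hp hr hu
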